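/- Let $X$ be a proper CAT(0) space, let $x_0\in X$, and let $\omega$ be a non-principal ultrafilter on $\mathbb N$. Let $\partial X$ be the set of geodesic rays $[0,\infty)\to X$ issuing from $x_0$, with the angle metric $$\angle(\alpha,\beta)=\sup\{\overline\angle_{x_0}(\alpha(t),\beta(t')) : t,t'>0\},$$ where $\overline\angle$ denotes the Euclidean comparison angle, and let the Tits metric $d_T$, with values in $[0,\infty]$, be the path metric induced by $\angle$. A scaling sequence is a sequence $d=(d_n)$ of positive real numbers which is $\omega$-divergent, that is, has no $\omega$-limit in $\mathbb R$. For a scaling sequence $d$ let $\mathrm{Con}^\omega(X,(x_0),d)$ be the asymptotic cone of $X$: the set of sequences $(x_n)$ in $X$ with $\mathrm d(x_n,x_0)/d_n$ bounded, with the metric $\lim^\omega \mathrm d(x_n,y_n)/d_n$, where sequences at distance $0$ are identified; its basepoint is the class $(x_0)$ of the constant sequence. For $\alpha\in\partial X$ and $t\ge 0$ put $\Psi_d(t,\alpha)=(\alpha(td_n))_n\in \mathrm{Con}^\omega(X,(x_0),d)$, and let $\overline\Psi_d(\alpha)$ be the geodesic ray $t\mapsto\Psi_d(t,\alpha)$ of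 the asymptotic cone, which issues from $(x_0)$. The Tits distance between rays of the asymptotic cone issuing from $(x_0)$ is defined in the same way as in $X$. Let $\alpha,\beta\in\partial X$. Then the following are equivalent. 1. $d_T(\alpha,\beta)<\infty$. 2. For every scaling sequence $d$, $d_T(\overline\Psi_d(\alpha),\overline\Psi_d(\beta))<\infty$. 3. For some scaling sequence $d$, $d_T(\overline\Psi_d(\alpha),\overline\Psi_d(\beta))<\infty$. 4. For every scaling sequence $d$ and every $t>0$, the points $\Psi_d(t,\alpha)$ and $\Psi_d(t,\beta)$ lie in the same connected component of $\mathrm{Con}^\omega(X,(x_0),d)\setminus\{(x_0)\}$. 5. For some scaling sequence $d$ and every $t>0$, the points $\Psi_d(t,\alpha)$ and $\Psi_d(t,\beta)$ lie in the same connected component of $\mathrm{Con}^\omega(X,(x_0),d)\setminus\{(x_0)\}$. 6. For every scaling sequence $d$ there is some $t>0$ such that $\Psi_d(t,\alpha)$ and $\Psi_d(t,\beta)$ lie in the same connected component of $\mathrm{Con}^\omega(X,(x_0),d)\setminus\{(x_0)\}$. 7. For some scaling sequence $d$ and some $t>0$, the points $\Psi_d(t,\alpha)$ and $\Psi_d(t,\beta)$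 lie in the same connected component of $\mathrm{Con}^\omega(X,(x_0),d)\setminus\{(x_0)\}$. -/

import Mathlib

open Filter Topology
open scoped NNReal ENNReal

noncomputable section

namespace CatZero

/-! ### CAT(0) spaces -/

/-- `c` restricted to `[0, dist x y]` is a geodesic from `x` to `y`. -/
structure IsGeodesicSegment {X : Type*} [MetricSpace X] (x y : X) (c : ℝ → X) : Prop where
  source : c 0 = x
  target : c (dist x y) = y
  isometry : ∀ s ∈ Set.Icc 0 (dist x y), ∀ t ∈ Set.Icc 0 (dist x y), dist (c s) (c t) = |s - t|

/-- A CAT(0) space: a uniquely geodesic metric space all of whose geodesic triangles are at least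
as thin as their comparison triangles in the Euclidean plane.  Any two sides of a triangle have a
common vertex, here called `p`; since the vertices are arbitrary, all pairs of sides are covered.
The point of `[p, q]` at distance `s * dist p q` from `p` has as comparison point the point of
the segment `[p', q']` with affine parameter `s`. -/
structure IsCAT0 (X : Type*) [MetricSpace X] : Prop where
  exists_geodesic : ∀ x y : X, ∃ c : ℝ → X, IsGeodesicSegment x y c
  unique_geodesic : ∀ (x y : X) (c c' : ℝ → X), IsGeodesicSegment x y c →
    IsGeodesicSegment x y c' → Set.EqOn c c' (Set.Icc 0 (dist x y))
  thin : ∀ (p q r : X) (c c' : ℝ → X), IsGeodesicSegment p q c → IsGeodesicSegment p r c' →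
    ∀ p' q' r' : EuclideanSpace ℝ (Fin 2),
      dist p' q' = dist p q → dist q' r' = dist q r → dist p' r' = dist p r →
      ∀ s ∈ Set.Icc (0 : ℝ) 1, ∀ t ∈ Set.Icc (0 : ℝ) 1,
        dist (c (s * dist p q)) (c' (t * dist p r)) ≤
          dist (AffineMap.lineMap p' q' s) (AffineMap.lineMap p' r' t)

/-! ### Geodesic rays, the angle metric and the Tits metric -/

/-- The boundary `∂X`, as the set of geodesic rays `[0, ∞) → X` issuing from `x₀`. -/
structure Ray (X : Type*) [MetricSpace X] (x₀ : X) where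
  toFun : ℝ≥0 → X
  isometry : Isometry toFun
  source : toFun 0 = x₀

instance {X : Type*} [MetricSpace X] (x₀ : X) : CoeFun (Ray X x₀) (fun _ => ℝ≥0 → X) :=
  ⟨Ray.toFun⟩

/-- The comparison angle at `x` between `y` and `z` (for `y ≠ x` and `z ≠ x`): the angle at the
vertex corresponding to `x` of a Euclidean triangle with the same side lengths. -/
def compAngle {X : Type*} [MetricSpace X] (x y z : X) : ℝ :=
  Real.arccos ((dist x y ^ 2 + dist x z ^ 2 - dist y z ^ 2) / (2 * dist x y * dist x z))

/-- The angle metric `∠(α, β)` on `∂X`: the supremum of the comparison angles at `x₀` between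
`α t` and `β t'` over all `t, t' > 0`. -/
def angle {X : Type*} [MetricSpace X] {x₀ : X} (α β : Ray X x₀) : ℝ :=
  sSup {θ : ℝ | ∃ t t' : ℝ≥0, 0 < t ∧ 0 < t' ∧ θ = compAngle x₀ (α t) (β t')}

/-- The length, with respect to a distance function `ρ`, of `c : [0,1] → B`: the supremum over
all finite subdivisions of the sum of the distances of consecutive points. -/
def pathLength {B : Type*} (ρ : B → B → ℝ) (c : unitInterval → B) : ℝ≥0∞ :=
  ⨆ (k : ℕ) (u : {u : ℕ → unitInterval // Monotone u}),
    ∑ i ∈ Finset.range k, ENNReal.ofReal (ρ (c (u.1 i)) (c (u.1 (i + 1))))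

/-- `c : [0,1] → B` is continuous with respect to the distance function `ρ`. -/
def IsPath {B : Type*} (ρ : B → B → ℝ) (c : unitInterval → B) : Prop :=
  ∀ s : unitInterval, Tendsto (fun s' => ρ (c s) (c s')) (𝓝 s) (𝓝 0)

/-- The path metric induced by `ρ`: the infimum of the lengths of the paths from `a` to `b`
(`∞` if there is none). -/
def pathDist {B : Type*} (ρ : B → B → ℝ) (a b : B) : ℝ≥0∞ :=
  ⨅ (c : unitInterval → B) (_ : IsPath ρ c ∧ c 0 = a ∧ c 1 = b), pathLength ρ c

/-- The Tits metric on `∂X`: the path metric induced by the angle metric. -/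
def titsDist {X : Type*} [MetricSpace X] {x₀ : X} (α β : Ray X x₀) : ℝ≥0∞ :=
  pathDist angle α β

/-! ### Asymptotic cones -/

/-- `ω` is non-principal: no finite set is `ω`-large. -/
def IsNonprincipal (ω : Ultrafilter ℕ) : Prop := ∀ A : Set ℕ, A.Finite → A ∉ ω

/-- A scaling sequence: an `ω`-divergent sequence of positive real numbers, that is, one without
an ultralimit in `ℝ`. -/
structure ScalingSequence (ω : Ultrafilter ℕ) where
  val : ℕ → ℝ≥0
  pos : ∀ n, 0 < val n
  divergent : ¬ ∃ L : ℝ, Tendsto (fun n => (val n : ℝ)) ω (𝓝 L)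

/-- The ultralimit of a sequence of real numbers (meaningful when it exists, as it does for every
bounded sequence). -/
def ultralim (ω : Ultrafilter ℕ) (f : ℕ → ℝ) : ℝ := limUnder (ω : Filter ℕ) f

theorem tendsto_ultralim {ω : Ultrafilter ℕ} {f : ℕ → ℝ} {C : ℝ} (h0 : ∀ n, 0 ≤ f n)
    (hC : ∀ n, f n ≤ C) : Tendsto f ω (𝓝 (ultralim ω f)) := by
  have hmem : (ω.map f : Filter ℝ) ≤ 𝓟 (Set.Icc 0 C) := by
    rw [le_principal_iff]
    exact Filter.mem_map.2 (Filter.univ_mem' fun n => ⟨h0 n, hC n⟩)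
  obtain ⟨L, _, hL⟩ := isCompact_Icc.ultrafilter_le_nhds (ω.map f) hmem
  exact tendsto_nhds_limUnder ⟨L, hL⟩

/-- The sequences in `X` at uniformly bounded distance from `e` in the rescaled metrics
`dist / d n`. -/
def BoundedSeq {X : Type*} [MetricSpace X] (ω : Ultrafilter ℕ) (e : ℕ → X)
    (d : ScalingSequence ω) : Type _ :=
  {x : ℕ → X // ∃ C : ℝ, ∀ n, dist (x n) (e n) / d.val n ≤ C}

section Cone

variable {X : Type*} [MetricSpace X] {ω : Ultrafilter ℕ} {e : ℕ → X} {d : ScalingSequence ω}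

theorem BoundedSeq.tendsto (x y : BoundedSeq ω e d) :
    Tendsto (fun n => dist (x.1 n) (y.1 n) / d.val n) ω
      (𝓝 (ultralim ω fun n => dist (x.1 n) (y.1 n) / d.val n)) := by
  obtain ⟨C, hC⟩ := x.2
  obtain ⟨D, hD⟩ := y.2
  refine tendsto_ultralim (C := C + D) (fun n => by positivity) (fun n => ?_)
  calc dist (x.1 n) (y.1 n) / d.val n
      ≤ (dist (x.1 n) (e n) + dist (y.1 n) (e n)) / d.val n := by
        gcongr
        exact dist_triangle_right _ _ _
    _ = dist (x.1 n) (e n) / d.val n + dist (y.1 n) (e n) / d.val n := add_div _ _ _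
    _ ≤ C + D := add_le_add (hC n) (hD n)

/-- The pseudometric `lim^ω dist (x n) (y n) / d n`. -/
instance : PseudoMetricSpace (BoundedSeq ω e d) where
  dist x y := ultralim ω fun n => dist (x.1 n) (y.1 n) / d.val n
  dist_self x := tendsto_nhds_unique (BoundedSeq.tendsto x x) (by simp)
  dist_comm x y := by simp only [dist_comm]
  dist_triangle x y z := by
    refine le_of_tendsto_of_tendsto' (BoundedSeq.tendsto x z)
      ((BoundedSeq.tendsto x y).add (BoundedSeq.tendsto y z)) (fun n => ?_)
    rw [← add_div]
    gcongr
    exact dist_triangle _ _ _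

end Cone

/-- The asymptotic cone of `X` with ultrafilter `ω`, observation sequence `e` and scaling
sequence `d`: bounded sequences, two of them being identified when `lim^ω dist (x n) (y n) / d n`
is zero, with the metric given by this ultralimit. -/
def AsympCone {X : Type*} [MetricSpace X] (ω : Ultrafilter ℕ) (e : ℕ → X)
    (d : ScalingSequence ω) : Type _ :=
  SeparationQuotient (BoundedSeq ω e d)

instance {X : Type*} [MetricSpace X] (ω : Ultrafilter ℕ) (e : ℕ → X) (d : ScalingSequence ω) :
    MetricSpace (AsympCone ω e d) :=
  inferInstanceAs (MetricSpace (SeparationQuotient (BoundedSeq ω e d)))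

section Psi

variable {X : Type*} [MetricSpace X] {ω : Ultrafilter ℕ}

/-- The basepoint `(x₀)` of the asymptotic cone with constant observation sequence `x₀`. -/
def basepoint (d : ScalingSequence ω) (x₀ : X) : AsympCone ω (fun _ => x₀) d :=
  SeparationQuotient.mk ⟨fun _ => x₀, 0, fun n => by simp⟩

theorem Ray.dist_eq {x₀ : X} (α : Ray X x₀) (s t : ℝ≥0) : dist (α s) (α t) = |(s : ℝ) - t| := by
  rw [α.isometry.dist_eq, NNReal.dist_eq]

theorem Ray.dist_scaled {x₀ : X} (α : Ray X x₀) (d : ScalingSequence ω) (s t : ℝ≥0) (n : ℕ) :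
    dist (α (s * d.val n)) (α (t * d.val n)) / d.val n = |(s : ℝ) - t| := by
  have h : (0 : ℝ) < d.val n := d.pos n
  rw [α.dist_eq, NNReal.coe_mul, NNReal.coe_mul, ← sub_mul, abs_mul, abs_of_pos h,
    mul_div_cancel_right₀ _ h.ne']

/-- `Ψ_d(t, α)`, the point of the asymptotic cone represented by the sequence `α (t * d n)`. -/
def Psi {x₀ : X} (d : ScalingSequence ω) (t : ℝ≥0) (α : Ray X x₀) :
    AsympCone ω (fun _ => x₀) d :=
  SeparationQuotient.mk ⟨fun n => α (t * d.val n), t, fun n => by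
    have h := α.dist_scaled d t 0 n
    rw [zero_mul, α.source] at h
    rw [h]
    simp⟩

theorem dist_Psi {x₀ : X} (d : ScalingSequence ω) (s t : ℝ≥0) (α : Ray X x₀) :
    dist (Psi d s α) (Psi d t α) = dist s t := by
  have h : dist (Psi d s α) (Psi d t α) =
      ultralim ω fun n => dist (α (s * d.val n)) (α (t * d.val n)) / d.val n := rfl
  rw [h, NNReal.dist_eq]
  simp only [α.dist_scaled]
  exact tendsto_const_nhds.limUnder_eq

theorem Psi_zero {x₀ : X} (d : ScalingSequence ω) (α : Ray X x₀) :
    Psi d 0 α = basepoint d x₀ := by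
  unfold Psi basepoint
  congr 1
  apply Subtype.ext
  funext n
  simp [α.source]

/-- The ray `t ↦ Ψ_d(t, α)` of the asymptotic cone, issuing from `(x₀)`. -/
def PsiBar {x₀ : X} (d : ScalingSequence ω) (α : Ray X x₀) :
    Ray (AsympCone ω (fun _ => x₀) d) (basepoint d x₀) where
  toFun t := Psi d t α
  isometry := Isometry.of_dist_eq fun s t => dist_Psi d s t α
  source := Psi_zero d α

end Psi

end CatZero

end

namespace CatZero

variable {X : Type*} [MetricSpace X]

/-! ### Comparison of triangles -/

/-! Comparison angles are invariant under rescaling, so passing to the cone does not increase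
`angle`, and a path of rays in `X` gives one in every cone. Evaluation of a path of rays at a time
`t > 0` is continuous and avoids the basepoint. This gives every implication leading from 1 towards
7, without curvature.

The substance is 7 → 1. A point of the cone other than the basepoint has a direction in `∂X`, the
ultralimit of geodesics from `x₀` to a representing sequence, and nearby points have directions with
short chords (`IsCAT0.chordLE_of_isDirection`). A connected component therefore yields a finite
chain of rays from `α` to `β` with chords at most `2 * sin (π / 4) * t`. Inserting limits of
geodesics to midpoints doubles the number of steps and halves their angular bound
(`IsCAT0.exists_ray_halving`). The total stays bounded, so the refined chains have a Lipschitz path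
as ultralimit (`exists_lipschitz_path`), whose length for `angle` is finite. -/

theorem exists_comparison_triangle {a b c : ℝ} (ha : 0 < a) (hb : 0 < b) (hc : 0 ≤ c)
    (h₁ : a ≤ b + c) (h₂ : b ≤ a + c) (h₃ : c ≤ a + b) :
    ∃ q r : EuclideanSpace ℝ (Fin 2), dist 0 q = a ∧ dist q r = c ∧ dist 0 r = b := by
  -- With `q = (a, 0)`, the law of cosines forces this first coordinate of `r`; the triangle
  -- inequalities give `|x| ≤ b`.
  set x := (a ^ 2 + b ^ 2 - c ^ 2) / (2 * a) with hx
  have hxa : 2 * a * x = a ^ 2 + b ^ 2 - c ^ 2 := by rw [hx]; field_simp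
  have hx2 : x ^ 2 ≤ b ^ 2 := by
    apply sq_le_sq'
    · have : 0 ≤ 2 * a * (x + b) := by nlinarith
      nlinarith [nonneg_of_mul_nonneg_right this (by positivity)]
    · have : 0 ≤ 2 * a * (b - x) := by nlinarith
      nlinarith [nonneg_of_mul_nonneg_right this (by positivity)]
  have hy : √(b ^ 2 - x ^ 2) ^ 2 = b ^ 2 - x ^ 2 := Real.sq_sqrt (by linarith)
  refine ⟨!₂[a, 0], !₂[x, √(b ^ 2 - x ^ 2)], ?_, ?_, ?_⟩
  · rw [EuclideanSpace.dist_eq]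
    simp [Fin.sum_univ_two, Real.dist_eq, Real.sqrt_sq ha.le]
  · rw [EuclideanSpace.dist_eq, Real.sqrt_eq_iff_mul_self_eq (by positivity) hc]
    simp only [Fin.sum_univ_two, Real.dist_eq, sq_abs]
    simp only [Matrix.cons_val_zero, Matrix.cons_val_one, zero_sub, neg_sq, hy]
    linarith
  · rw [EuclideanSpace.dist_eq, Real.sqrt_eq_iff_mul_self_eq (by positivity) hb.le]
    simp only [Fin.sum_univ_two, Real.dist_eq, sq_abs]
    simp only [Matrix.cons_val_zero, Matrix.cons_val_one, PiLp.zero_apply,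
      zero_sub, neg_sq, hy]
    ring

/-- Comparison angles are monotone along the two sides of a triangle. -/
theorem IsCAT0.comparison (hX : IsCAT0 X) {p q r : X} {c c' : ℝ → X}
    (hc : IsGeodesicSegment p q c) (hc' : IsGeodesicSegment p r c')
    (hq : 0 < dist p q) (hr : 0 < dist p r) {u v : ℝ}
    (hu : u ∈ Set.Icc 0 (dist p q)) (hv : v ∈ Set.Icc 0 (dist p r)) :
    u * v * (dist p q ^ 2 + dist p r ^ 2 - dist q r ^ 2) ≤
      dist p q * dist p r * (u ^ 2 + v ^ 2 - dist (c u) (c' v) ^ 2) := by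
  obtain ⟨q', r', h1, h2, h3⟩ := exists_comparison_triangle hq hr (dist_nonneg (x := q) (y := r))
    (by linarith [dist_triangle p r q, dist_comm q r]) (by linarith [dist_triangle p q r])
    (by linarith [dist_triangle q p r, dist_comm p q])
  have key := hX.thin p q r c c' hc hc' 0 q' r' h1 h2 h3 (u / dist p q)
    ⟨div_nonneg hu.1 hq.le, div_le_one_of_le₀ hu.2 hq.le⟩ (v / dist p r)
    ⟨div_nonneg hv.1 hr.le, div_le_one_of_le₀ hv.2 hr.le⟩
  rw [div_mul_cancel₀ _ hq.ne', div_mul_cancel₀ _ hr.ne'] at key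
  have key2 := pow_le_pow_left₀ dist_nonneg key 2
  rw [dist_zero_left] at h1 h3
  have h4 := norm_sub_sq_real q' r'
  rw [← dist_eq_norm, h1, h2, h3] at h4
  rw [dist_eq_norm (AffineMap.lineMap _ _ _) (AffineMap.lineMap _ _ _)] at key2
  simp only [AffineMap.lineMap_apply, vsub_eq_sub, sub_zero, vadd_eq_add, add_zero] at key2
  rw [norm_sub_sq_real, norm_smul, norm_smul, inner_smul_left, inner_smul_right, h1, h3,
    Real.norm_of_nonneg (div_nonneg hu.1 hq.le), Real.norm_of_nonneg (div_nonneg hv.1 hr.le),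
    div_mul_cancel₀ _ hq.ne', div_mul_cancel₀ _ hr.ne'] at key2
  simp only [conj_trivial] at key2
  -- Polarisation turns the inner product into side lengths. Cleared of denominators, the inequality
  -- also covers `u = 0` and `v = 0`.
  have h5 : dist p q * dist p r * (2 * (u / dist p q * (v / dist p r * inner ℝ q' r'))) =
      u * v * (dist p q ^ 2 + dist p r ^ 2 - dist q r ^ 2) := by
    field_simp
    linear_combination (u * v) * h4
  rw [← h5]
  gcongr
  linarith

theorem two_mul_one_sub_cos (φ : ℝ) : 2 * (1 - Real.cos φ) = (2 * Real.sin (φ / 2)) ^ 2 := by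
  have h := Real.cos_two_mul (φ / 2)
  rw [mul_div_cancel₀ φ two_ne_zero] at h
  linear_combination (-2) * h - 4 * Real.sin_sq_add_cos_sq (φ / 2)

/-- In the plane, a point within `sin φ * |pq|` of `q` is seen from `p` at angle at most `φ` from
`q`: the extreme case is a tangent to the circle. The conclusion is the chord of an angle `φ` at
radius `t`. -/
theorem IsCAT0.dist_le_of_dist_le_sin (hX : IsCAT0 X) {p q r : X} {c c' : ℝ → X}
    (hc : IsGeodesicSegment p q c) (hc' : IsGeodesicSegment p r c')
    (hq : 0 < dist p q) (hr : 0 < dist p r) {φ : ℝ} (hφ₀ : 0 ≤ φ) (hφ : φ ≤ Real.pi / 2)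
    (h : dist q r ≤ Real.sin φ * dist p q) {t : ℝ} (ht : 0 ≤ t) (htq : t ≤ dist p q)
    (htr : t ≤ dist p r) : dist (c t) (c' t) ≤ 2 * Real.sin (φ / 2) * t := by
  have key := hX.comparison hc hc' hq hr ⟨ht, htq⟩ ⟨ht, htr⟩
  have hs : 0 ≤ Real.sin (φ / 2) :=
    Real.sin_nonneg_of_nonneg_of_le_pi (by linarith) (by linarith [Real.pi_pos])
  refine le_of_sq_le_sq ?_ (by positivity)
  have h2 := pow_le_pow_left₀ dist_nonneg h 2
  have h3 := Real.sin_sq_add_cos_sq φ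
  have h4 : 2 * dist p q * dist p r * Real.cos φ ≤ dist p q ^ 2 + dist p r ^ 2 - dist q r ^ 2 := by
    have h5 : (Real.sin φ * dist p q) ^ 2 = dist p q ^ 2 - (Real.cos φ * dist p q) ^ 2 := by
      rw [mul_pow, mul_pow]
      linear_combination dist p q ^ 2 * h3
    linarith [sq_nonneg (Real.cos φ * dist p q - dist p r)]
  have h6 := (mul_le_mul_of_nonneg_left h4 (mul_nonneg ht ht)).trans key
  rw [show t * t * (2 * dist p q * dist p r * Real.cos φ) =
    dist p q * dist p r * (t * t * (2 * Real.cos φ)) by ring] at h6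
  have h7 := le_of_mul_le_mul_left h6 (mul_pos hq hr)
  rw [mul_pow, ← two_mul_one_sub_cos]
  linarith

/-! ### Limits of geodesics -/

theorem Ray.ext {x₀ : X} {α β : Ray X x₀} (h : ∀ t, α t = β t) : α = β := by
  cases α; cases β; congr; exact funext h

theorem Ray.dist_source {x₀ : X} (α : Ray X x₀) (t : ℝ≥0) : dist x₀ (α t) = t := by
  have h := α.dist_eq 0 t
  rwa [α.source, NNReal.coe_zero, zero_sub, abs_neg, NNReal.abs_eq] at h

theorem Ray.isGeodesicSegment {x₀ : X} (α : Ray X x₀) (t : ℝ≥0) :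
    IsGeodesicSegment x₀ (α t) fun s => α s.toNNReal where
  source := by simp [α.source]
  target := by simp [α.dist_source]
  isometry s hs s' hs' := by
    rw [α.dist_eq, Real.coe_toNNReal _ hs.1, Real.coe_toNNReal _ hs'.1]

/-- Each time slice eventually lies in a compact ball, so the ultrafilter gives all limits at once,
without subsequences. Distances need only be right eventually, because segments of growing length
reach a given time only eventually. -/
theorem exists_limit_ray [ProperSpace X] {ι : Type*} (F : Ultrafilter ι) {x₀ : X}
    (g : ι → ℝ≥0 → X) (h₀ : ∀ i, g i 0 = x₀)
    (hg : ∀ s t, ∀ᶠ i in F, dist (g i s) (g i t) = dist s t) :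
    ∃ γ : Ray X x₀, ∀ t, Tendsto (fun i => g i t) F (𝓝 (γ t)) := by
  have hlim : ∀ t, ∃ y, Tendsto (fun i => g i t) F (𝓝 y) := by
    intro t
    have hmem : (F.map fun i => g i t : Filter X) ≤ 𝓟 (Metric.closedBall x₀ (dist t 0)) := by
      rw [le_principal_iff]
      change ∀ᶠ i in F, dist (g i t) x₀ ≤ dist t 0
      filter_upwards [hg t 0] with i hi
      rw [h₀] at hi
      exact hi.le
    obtain ⟨y, _, hy⟩ := (isCompact_closedBall x₀ (dist t 0)).ultrafilter_le_nhds _ hmem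
    exact ⟨y, hy⟩
  choose γ hγ using hlim
  refine ⟨⟨γ, Isometry.of_dist_eq fun s t => ?_, ?_⟩, hγ⟩
  · refine tendsto_nhds_unique ((hγ s).dist (hγ t)) ?_
    exact tendsto_const_nhds.congr' ((hg s t).mono fun i hi => hi.symm)
  · exact tendsto_nhds_unique (hγ 0) (by simp only [h₀]; exact tendsto_const_nhds)

theorem exists_limit_ray_of_geodesics [ProperSpace X] {ι : Type*} (F : Ultrafilter ι) {x₀ : X}
    {x : ι → X} {G : ι → ℝ → X} (hG : ∀ i, IsGeodesicSegment x₀ (x i) (G i))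
    (hx : Tendsto (fun i => dist x₀ (x i)) F atTop) :
    ∃ γ : Ray X x₀, ∀ t : ℝ≥0, Tendsto (fun i => G i t) F (𝓝 (γ t)) := by
  refine exists_limit_ray F (fun i t => G i t) (fun i => (hG i).source) fun s t => ?_
  filter_upwards [hx.eventually_ge_atTop (s : ℝ), hx.eventually_ge_atTop (t : ℝ)] with i hs ht
  exact (hG i).isometry s ⟨s.2, hs⟩ t ⟨t.2, ht⟩

/-- The chords between points of `α` and `β` at the same time `t` have length at most `ε * t`. -/
def ChordLE {x₀ : X} (α β : Ray X x₀) (ε : ℝ) : Prop :=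
  ∀ t : ℝ≥0, dist (α t) (β t) ≤ ε * t

theorem ChordLE.symm {x₀ : X} {α β : Ray X x₀} {ε : ℝ} (h : ChordLE α β ε) : ChordLE β α ε :=
  fun t => dist_comm (α t) (β t) ▸ h t

theorem IsCAT0.chordLE_of_tendsto (hX : IsCAT0 X) {ι : Type*} (F : Ultrafilter ι) {x₀ : X}
    {x y : ι → X} {G H : ι → ℝ → X} (hG : ∀ i, IsGeodesicSegment x₀ (x i) (G i))
    (hH : ∀ i, IsGeodesicSegment x₀ (y i) (H i))
    (hx : Tendsto (fun i => dist x₀ (x i)) F atTop)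
    (hy : Tendsto (fun i => dist x₀ (y i)) F atTop) {γ γ' : Ray X x₀}
    (hγ : ∀ t : ℝ≥0, Tendsto (fun i => G i t) F (𝓝 (γ t)))
    (hγ' : ∀ t : ℝ≥0, Tendsto (fun i => H i t) F (𝓝 (γ' t)))
    {φ : ℝ} (hφ₀ : 0 ≤ φ) (hφ : φ ≤ Real.pi / 2)
    (h : ∀ᶠ i in F, dist (x i) (y i) ≤ Real.sin φ * dist x₀ (x i)) :
    ChordLE γ γ' (2 * Real.sin (φ / 2)) := by
  intro t
  refine le_of_tendsto ((hγ t).dist (hγ' t)) ?_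
  filter_upwards [hx.eventually_ge_atTop (t : ℝ), hy.eventually_ge_atTop (t : ℝ),
    hx.eventually_gt_atTop 0, hy.eventually_gt_atTop 0, h] with i h1 h2 h3 h4 h5
  exact hX.dist_le_of_dist_le_sin (hG i) (hH i) h3 h4 hφ₀ hφ h5 t.2 h1 h2

/-! ### Halving a chord -/

theorem IsCAT0.exists_midpoint (hX : IsCAT0 X) (x y : X) :
    ∃ m : X, dist x m = dist x y / 2 ∧ dist m y = dist x y / 2 := by
  obtain ⟨c, hc⟩ := hX.exists_geodesic x y
  have h0 := dist_nonneg (x := x) (y := y)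
  refine ⟨c (dist x y / 2), ?_, ?_⟩
  · have := hc.isometry 0 ⟨le_rfl, h0⟩ (dist x y / 2) ⟨by linarith, by linarith⟩
    rwa [hc.source, zero_sub, abs_neg, abs_of_nonneg (by linarith)] at this
  · have := hc.isometry (dist x y / 2) ⟨by linarith, by linarith⟩ (dist x y) ⟨h0, le_rfl⟩
    rw [hc.target, abs_of_nonpos (by linarith)] at this
    linarith

/-- A chord `2 * sin φ` spans the angle `2 * φ`. The midpoint of `α n` and `β n` is within `sin φ *
n` of both, hence at comparison angle at most `φ` from each; the geodesics to these midpoints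
converge to `γ`. -/
theorem IsCAT0.exists_ray_halving [ProperSpace X] (hX : IsCAT0 X) {x₀ : X} {α β : Ray X x₀}
    {φ : ℝ} (hφ₀ : 0 ≤ φ) (hφ : φ < Real.pi / 2) (h : ChordLE α β (2 * Real.sin φ)) :
    ∃ γ : Ray X x₀, ChordLE α γ (2 * Real.sin (φ / 2)) ∧ ChordLE γ β (2 * Real.sin (φ / 2)) := by
  choose m hm₁ hm₂ using fun n : ℕ => hX.exists_midpoint (α n) (β n)
  choose G hG using fun n => hX.exists_geodesic x₀ (m n)
  have hsin : Real.sin φ < 1 := by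
    rw [← Real.sin_pi_div_two]
    exact Real.sin_lt_sin_of_lt_of_le_pi_div_two (by linarith) le_rfl hφ
  have hF : Tendsto (fun n : ℕ => (n : ℝ)) (hyperfilter ℕ) atTop :=
    tendsto_natCast_atTop_atTop.mono_left (Nat.hyperfilter_le_atTop)
  have hd : ∀ n : ℕ, dist (α n) (β n) ≤ 2 * Real.sin φ * n := fun n => by simpa using h n
  have hα : ∀ n : ℕ, dist x₀ (α n) = n := fun n => by simp [α.dist_source]
  have hβ : ∀ n : ℕ, dist x₀ (β n) = n := fun n => by simp [β.dist_source]
  have hm : Tendsto (fun n => dist x₀ (m n)) (hyperfilter ℕ) atTop := by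
    -- The midpoints escape to infinity since they are at distance at least `(1 - sin φ) * n` from
    -- `x₀`; this is where `φ < π / 2` enters.
    refine tendsto_atTop_mono (fun n => ?_) (hF.const_mul_atTop (sub_pos.2 hsin))
    have := dist_triangle_right x₀ (α n) (m n)
    rw [hα, hm₁] at this
    linarith [hd n]
  obtain ⟨γ, hγ⟩ := exists_limit_ray_of_geodesics _ hG hm
  refine ⟨γ, ?_, ChordLE.symm ?_⟩
  · refine hX.chordLE_of_tendsto (hyperfilter ℕ) (x := fun n => α n)
      (fun n => α.isGeodesicSegment n) hG (by simpa only [hα] using hF) hm (fun t => ?_) hγ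
      hφ₀ hφ.le (Eventually.of_forall fun n => ?_)
    · simp
    · rw [hα, hm₁]; linarith [hd n]
  · refine hX.chordLE_of_tendsto (hyperfilter ℕ) (x := fun n => β n)
      (fun n => β.isGeodesicSegment n) hG (by simpa only [hβ] using hF) hm (fun t => ?_) hγ
      hφ₀ hφ.le (Eventually.of_forall fun n => ?_)
    · simp
    · rw [hβ, dist_comm, hm₂]; linarith [hd n]

end CatZero

namespace CatZero

variable {X : Type*} [MetricSpace X]

/-! ### Chains of rays and the Tits metric -/

/-- There is a chain of `N` steps from `α` to `β` whose steps are chords of size `ε`. -/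
def Chain {x₀ : X} (N : ℕ) (ε : ℝ) (α β : Ray X x₀) : Prop :=
  ∃ c : ℕ → Ray X x₀, c 0 = α ∧ c N = β ∧ ∀ i < N, ChordLE (c i) (c (i + 1)) ε

theorem exists_chain_of_reflTransGen {x₀ : X} {ε : ℝ} {α β : Ray X x₀}
    (h : Relation.ReflTransGen (fun γ γ' => ChordLE γ γ' ε) α β) : ∃ N, Chain N ε α β := by
  induction h with
  | refl => exact ⟨0, fun _ => α, rfl, rfl, fun i hi => absurd hi (Nat.not_lt_zero i)⟩
  | @tail γ γ' _ hstep ih =>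
    obtain ⟨N, c, h0, hN, hc⟩ := ih
    refine ⟨N + 1, fun i => if i ≤ N then c i else γ', by simp [h0], by simp, fun i hi => ?_⟩
    rcases (Nat.lt_succ_iff.1 hi).lt_or_eq with h | rfl
    · simpa [h.le, Nat.succ_le_of_lt h] using hc i h
    · simpa [hN] using hstep

theorem IsCAT0.chain_halving [ProperSpace X] (hX : IsCAT0 X) {x₀ : X} {α β : Ray X x₀}
    {N : ℕ} {φ : ℝ} (hφ₀ : 0 ≤ φ) (hφ : φ < Real.pi / 2)
    (h : Chain N (2 * Real.sin φ) α β) : Chain (N * 2) (2 * Real.sin (φ / 2)) α β := by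
  obtain ⟨c, h0, hN, hc⟩ := h
  have hmid : ∀ i, ∃ γ, i < N → ChordLE (c i) γ (2 * Real.sin (φ / 2)) ∧
      ChordLE γ (c (i + 1)) (2 * Real.sin (φ / 2)) := by
    intro i
    by_cases hi : i < N
    · obtain ⟨γ, hγ⟩ := hX.exists_ray_halving hφ₀ hφ (hc i hi)
      exact ⟨γ, fun _ => hγ⟩
    · exact ⟨α, fun h => absurd h hi⟩
  choose m hm using hmid
  -- Even indices keep the old rays, odd indices carry the inserted ones.
  refine ⟨fun i => if i % 2 = 0 then c (i / 2) else m (i / 2), by simp [h0], by simp [hN],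
    fun i hi => ?_⟩
  rcases Nat.even_or_odd' i with ⟨j, rfl | rfl⟩
  · have h1 : (2 * j + 1) / 2 = j := by omega
    simpa [Nat.add_mod, h1] using (hm j (by omega)).1
  · have h1 : (2 * j + 1) / 2 = j := by omega
    have h2 : (2 * j + 1 + 1) / 2 = j + 1 := by omega
    have h3 : (2 * j + 1 + 1) % 2 = 0 := by omega
    simpa [Nat.add_mod, h1, h2, h3] using (hm j (by omega)).2

theorem IsCAT0.chain_refine [ProperSpace X] (hX : IsCAT0 X) {x₀ : X} {α β : Ray X x₀}
    {N : ℕ} {φ : ℝ} (hφ₀ : 0 ≤ φ) (hφ : φ < Real.pi / 2)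
    (h : Chain N (2 * Real.sin φ) α β) (n : ℕ) :
    Chain (N * 2 ^ n) (2 * Real.sin (φ / 2 ^ n)) α β := by
  induction n with
  | zero => simpa using h
  | succ n ih =>
    rw [pow_succ, ← mul_assoc, pow_succ, ← div_div]
    refine hX.chain_halving (by positivity) (lt_of_le_of_lt ?_ hφ) ih
    exact div_le_self hφ₀ (one_le_pow₀ one_le_two)

theorem dist_le_of_chain {x₀ : X} {c : ℕ → Ray X x₀} {N : ℕ} {ε : ℝ}
    (hc : ∀ i < N, ChordLE (c i) (c (i + 1)) ε) (t : ℝ≥0) {i j : ℕ} (hij : i ≤ j) (hj : j ≤ N) :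
    dist (c i t) (c j t) ≤ (j - i : ℝ) * ε * t := by
  induction j, hij using Nat.le_induction with
  | base => simp
  | succ j hij ih =>
    have h1 := ih (by omega)
    have h2 := hc j (by omega) t
    have h3 := dist_triangle (c i t) (c j t) (c (j + 1) t)
    push_cast
    linarith

/-- The `n`-th chain, read as a step function on `[0, 1]`, has total chord at most `N * 2 ^ n * 2 *
(φ / 2 ^ n) = 2 * N * φ`, independent of `n`. The path is the pointwise ultralimit of these step
functions. -/
theorem exists_lipschitz_path [ProperSpace X] {x₀ : X} {α β : Ray X x₀} {N : ℕ} {φ : ℝ}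
    (hφ : 0 ≤ φ) (h : ∀ n : ℕ, Chain (N * 2 ^ n) (2 * Real.sin (φ / 2 ^ n)) α β) :
    ∃ c : unitInterval → Ray X x₀, c 0 = α ∧ c 1 = β ∧
      ∀ s s' : unitInterval, s ≤ s' → ChordLE (c s) (c s') (2 * N * φ * (s' - s)) := by
  choose C h0 hN hC using h
  have hlim : ∀ s : unitInterval, ∃ γ : Ray X x₀, ∀ t,
      Tendsto (fun n => C n ⌊(s : ℝ) * (N * 2 ^ n : ℕ)⌋₊ t) (hyperfilter ℕ) (𝓝 (γ t)) := by
    intro s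
    refine exists_limit_ray (hyperfilter ℕ) (fun n t => C n ⌊(s : ℝ) * (N * 2 ^ n : ℕ)⌋₊ t)
      (fun n => (C n _).source) fun t t' => Eventually.of_forall fun n => ?_
    exact (C n _).isometry.dist_eq t t'
  choose c hc using hlim
  refine ⟨c, ?_, ?_, fun s s' hss t => ?_⟩
  · refine Ray.ext fun t => tendsto_nhds_unique (hc 0 t) ?_
    simp [h0]
  · refine Ray.ext fun t => tendsto_nhds_unique (hc 1 t) ?_
    simp only [Set.Icc.coe_one, one_mul, Nat.floor_natCast, hN]
    exact tendsto_const_nhds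
  · have hF : Tendsto (fun n : ℕ => (2 : ℝ) ^ n) (hyperfilter ℕ) atTop :=
      (tendsto_pow_atTop_atTop_of_one_lt one_lt_two).mono_left (Nat.hyperfilter_le_atTop)
    -- The second summand is the cost of rounding to integer indices: at most one extra step.
    have hbound : Tendsto (fun n : ℕ => (2 * N * φ * (s' - s) + 2 * φ * ((2 : ℝ) ^ n)⁻¹) * t)
        (hyperfilter ℕ) (𝓝 ((2 * N * φ * (s' - s) + 2 * φ * 0) * t)) :=
      ((hF.inv_tendsto_atTop.const_mul _).const_add _).mul_const _
    rw [mul_zero, add_zero] at hbound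
    refine le_of_tendsto_of_tendsto' ((hc s t).dist (hc s' t)) hbound fun n => ?_
    have hs0 : (0 : ℝ) ≤ s := s.2.1
    have hM : (0 : ℝ) ≤ (N * 2 ^ n : ℕ) := Nat.cast_nonneg _
    have hss' : (s : ℝ) ≤ s' := hss
    have hle : ⌊(s : ℝ) * (N * 2 ^ n : ℕ)⌋₊ ≤ ⌊(s' : ℝ) * (N * 2 ^ n : ℕ)⌋₊ :=
      Nat.floor_le_floor (by gcongr)
    have hleN : ⌊(s' : ℝ) * (N * 2 ^ n : ℕ)⌋₊ ≤ N * 2 ^ n :=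
      Nat.floor_le_of_le (mul_le_of_le_one_left hM s'.2.2)
    refine (dist_le_of_chain (hC n) t hle hleN).trans ?_
    have h1 := Nat.lt_floor_add_one ((s : ℝ) * (N * 2 ^ n : ℕ))
    have h2 := Nat.floor_le (mul_nonneg (hs0.trans hss') hM)
    have h3 : Real.sin (φ / 2 ^ n) ≤ φ / 2 ^ n := Real.sin_le (by positivity)
    have h4 : (0 : ℝ) ≤ ⌊(s' : ℝ) * (N * 2 ^ n : ℕ)⌋₊ - ⌊(s : ℝ) * (N * 2 ^ n : ℕ)⌋₊ :=
      sub_nonneg.2 (by exact_mod_cast hle)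
    gcongr
    refine (mul_le_mul_of_nonneg_left (mul_le_mul_of_nonneg_left h3 zero_le_two) h4).trans ?_
    calc _ ≤ ((s' : ℝ) * (N * 2 ^ n : ℕ) - s * (N * 2 ^ n : ℕ) + 1) * (2 * (φ / 2 ^ n)) := by
          gcongr
          linarith
      _ = _ := by push_cast; field_simp

/-- Chords of size `ε` at equal times bound all comparison angles at the origin. -/
theorem IsCAT0.angle_le (hX : IsCAT0 X) {x₀ : X} {α β : Ray X x₀} {ε : ℝ} (hε : 0 ≤ ε)
    (h : ChordLE α β ε) : angle α β ≤ Real.pi / 2 * ε := by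
  refine csSup_le ⟨_, 1, 1, one_pos, one_pos, rfl⟩ ?_
  rintro _ ⟨t, t', ht, ht', rfl⟩
  rw [compAngle, α.dist_source, β.dist_source]
  have htR : (0 : ℝ) < t := ht
  have htR' : (0 : ℝ) < t' := ht'
  -- Monotonicity of comparison angles reduces the times `t, t'` to the common time `T`, where the
  -- chord bound applies.
  set T := max t t' with hT
  have hTpos : (0 : ℝ) < T := lt_of_lt_of_le htR (by exact_mod_cast le_max_left t t')
  have key := hX.comparison (α.isGeodesicSegment T) (β.isGeodesicSegment T) (u := t) (v := t')
    (by rwa [α.dist_source]) (by rwa [β.dist_source])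
    (by rw [α.dist_source]; exact ⟨t.2, by exact_mod_cast le_max_left t t'⟩)
    (by rw [β.dist_source]; exact ⟨t'.2, by exact_mod_cast le_max_right t t'⟩)
  simp only [α.dist_source, β.dist_source, Real.toNNReal_coe] at key
  have hd := pow_le_pow_left₀ dist_nonneg (h T) 2
  have h1 : (t * t' : ℝ) * (2 - ε ^ 2) ≤ t ^ 2 + t' ^ 2 - dist (α t) (β t') ^ 2 := by
    have h2 : (t * t' : ℝ) * ((2 - ε ^ 2) * T ^ 2) ≤
        t * t' * (T ^ 2 + T ^ 2 - dist (α T) (β T) ^ 2) := by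
      gcongr
      linarith
    have h3 : (T * T : ℝ) * (t * t' * (2 - ε ^ 2)) ≤
        T * T * (t ^ 2 + t' ^ 2 - dist (α t) (β t') ^ 2) := by
      linarith
    exact le_of_mul_le_mul_left h3 (by positivity)
  have hx : 1 - ε ^ 2 / 2 ≤ (t ^ 2 + t' ^ 2 - dist (α t) (β t') ^ 2) / (2 * t * t' : ℝ) := by
    rw [le_div_iff₀ (by positivity)]
    linarith
  have hx1 : (t ^ 2 + t' ^ 2 - dist (α t) (β t') ^ 2) / (2 * t * t' : ℝ) ≤ 1 := by
    rw [div_le_one (by positivity)]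
    have h5 := dist_triangle x₀ (α t) (β t')
    have h6 := dist_triangle_right x₀ (α t) (β t')
    rw [α.dist_source, β.dist_source] at h5 h6
    have h7 : ((t : ℝ) - t') ^ 2 ≤ dist (α t) (β t') ^ 2 :=
      sq_le_sq' (by linarith) (by linarith)
    linarith
  set x := (t ^ 2 + t' ^ 2 - dist (α t) (β t') ^ 2) / (2 * t * t' : ℝ)
  have hpi := Real.pi_pos
  -- The constant `π / 2` comes from `cos θ ≤ 1 - 2 * θ ^ 2 / π ^ 2` on `[-π, π]`. If `x < -1`, then
  -- `ε > 2` and the trivial bound `π` suffices.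
  rcases le_or_gt (-1) x with hx0 | hx0
  · have hcos := Real.cos_le_one_sub_mul_cos_sq (x := Real.arccos x)
      (by rw [abs_of_nonneg (Real.arccos_nonneg x)]; exact Real.arccos_le_pi x)
    rw [Real.cos_arccos hx0 hx1] at hcos
    refine le_of_sq_le_sq ?_ (by positivity)
    have h8 : 2 / Real.pi ^ 2 * Real.arccos x ^ 2 ≤ ε ^ 2 / 2 := by linarith
    rw [div_mul_eq_mul_div, div_le_iff₀ (by positivity)] at h8
    linarith
  · refine (Real.arccos_le_pi x).trans ?_
    have : 2 ≤ ε := by nlinarith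
    nlinarith

/-! ### Finite Tits distance from Lipschitz paths -/

theorem angle_nonneg {x₀ : X} (α β : Ray X x₀) : 0 ≤ angle α β := by
  refine Real.sSup_nonneg ?_
  rintro _ ⟨t, t', _, _, rfl⟩
  exact Real.arccos_nonneg _

theorem compAngle_le_angle {x₀ : X} (α β : Ray X x₀) {t t' : ℝ≥0} (ht : 0 < t) (ht' : 0 < t') :
    compAngle x₀ (α t) (β t') ≤ angle α β := by
  refine le_csSup ⟨Real.pi, ?_⟩ ⟨t, t', ht, ht', rfl⟩
  rintro _ ⟨t, t', _, _, rfl⟩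
  exact Real.arccos_le_pi _

/-- The sum over any subdivision telescopes to at most `K`; no triangle inequality for `ρ` is
involved. Symmetry serves continuity from the left. -/
theorem pathDist_lt_top_of_lipschitz {B : Type*} {ρ : B → B → ℝ} {K : ℝ} (hρ : ∀ a b, 0 ≤ ρ a b)
    (hsymm : ∀ a b, ρ a b = ρ b a) {c : unitInterval → B}
    (hc : ∀ s s' : unitInterval, s ≤ s' → ρ (c s) (c s') ≤ K * (s' - s)) :
    pathDist ρ (c 0) (c 1) < ⊤ := by
  have hK : 0 ≤ K := by simpa using (hρ _ _).trans (hc 0 1 zero_le_one)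
  have hpath : IsPath ρ c := by
    intro s
    have hlim : Tendsto (fun s' : unitInterval => K * |(s' : ℝ) - s|) (𝓝 s) (𝓝 0) := by
      have : Continuous fun s' : unitInterval => K * |(s' : ℝ) - s| := by fun_prop
      simpa using this.tendsto s
    refine squeeze_zero (fun _ => hρ _ _) (fun s' => ?_) hlim
    rcases le_total s s' with h | h
    · exact (hc s s' h).trans (by gcongr; exact le_abs_self _)
    · rw [hsymm, abs_sub_comm]
      exact (hc s' s h).trans (by gcongr; exact le_abs_self _)
  have hlen : pathLength ρ c ≤ ENNReal.ofReal K := by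
    refine iSup₂_le fun k u => ?_
    rw [← ENNReal.ofReal_sum_of_nonneg fun i _ => hρ _ _]
    refine ENNReal.ofReal_le_ofReal ?_
    calc _ ≤ ∑ i ∈ Finset.range k, K * ((u.1 (i + 1) : ℝ) - u.1 i) :=
          Finset.sum_le_sum fun i _ => hc _ _ (u.2 i.le_succ)
      _ = K * ((u.1 k : ℝ) - u.1 0) := by
          rw [← Finset.mul_sum, Finset.sum_range_sub fun i => (u.1 i : ℝ)]
      _ ≤ K := mul_le_of_le_one_right hK (by linarith [(u.1 k).2.2, (u.1 0).2.1])
  exact (iInf₂_le c ⟨hpath, rfl, rfl⟩).trans_lt (hlen.trans_lt ENNReal.ofReal_lt_top)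

theorem compAngle_comm (x y z : X) : compAngle x y z = compAngle x z y := by
  simp only [compAngle, dist_comm y z]
  ring_nf

theorem angle_comm {x₀ : X} (α β : Ray X x₀) : angle α β = angle β α := by
  have h : ∀ α β : Ray X x₀, angle α β ≤ angle β α := fun α β => by
    refine csSup_le ⟨_, 1, 1, one_pos, one_pos, rfl⟩ ?_
    rintro _ ⟨t, t', ht, ht', rfl⟩
    rw [compAngle_comm]
    exact compAngle_le_angle β α ht' ht
  exact (h α β).antisymm (h β α)

theorem IsCAT0.titsDist_lt_top_of_reflTransGen [ProperSpace X] (hX : IsCAT0 X) {x₀ : X}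
    {α β : Ray X x₀} {φ : ℝ} (hφ₀ : 0 ≤ φ) (hφ : φ < Real.pi / 2)
    (h : Relation.ReflTransGen (fun γ γ' => ChordLE γ γ' (2 * Real.sin φ)) α β) :
    titsDist α β < ⊤ := by
  obtain ⟨N, hN⟩ := exists_chain_of_reflTransGen h
  obtain ⟨c, rfl, rfl, hc⟩ := exists_lipschitz_path hφ₀ (hX.chain_refine hφ₀ hφ hN)
  refine pathDist_lt_top_of_lipschitz (K := Real.pi / 2 * (2 * N * φ)) angle_nonneg angle_comm
    fun s s' hss => ?_
  rw [mul_assoc]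
  refine hX.angle_le ?_ (hc s s' hss)
  have : (s : ℝ) ≤ s' := hss
  have := sub_nonneg.2 this
  positivity

end CatZero

namespace CatZero

/-! ### Continuity of evaluation for the angle metric -/

section Evaluation

variable {Y : Type*} [MetricSpace Y] {o : Y}

theorem angle_le_pi (α β : Ray Y o) : angle α β ≤ Real.pi := by
  refine csSup_le ⟨_, 1, 1, one_pos, one_pos, rfl⟩ ?_
  rintro _ ⟨t, t', _, _, rfl⟩
  exact Real.arccos_le_pi _

/-- The law of cosines defines the comparison angle, which is at most `angle α β`, and cosine
decreases on `[0, π]`. Curvature plays no role, so this applies directly to the cone. -/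
theorem Ray.dist_le_sqrt_angle (α β : Ray Y o) {t : ℝ≥0} (ht : 0 < t) :
    dist (α t) (β t) ≤ √(2 * t ^ 2 * (1 - Real.cos (angle α β))) := by
  have htR : (0 : ℝ) < t := ht
  have h := compAngle_le_angle α β ht ht
  rw [compAngle, α.dist_source, β.dist_source] at h
  have hD : dist (α t) (β t) ≤ 2 * t := by
    have := dist_triangle_left (α t) (β t) o
    rw [α.dist_source, β.dist_source] at this
    linarith
  have hD2 := pow_le_pow_left₀ dist_nonneg hD 2
  have hcos := Real.cos_le_cos_of_nonneg_of_le_pi (Real.arccos_nonneg _) (angle_le_pi α β) h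
  rw [Real.cos_arccos (by rw [le_div_iff₀ (by positivity)]; linarith)
    (by rw [div_le_one (by positivity)]; linarith [sq_nonneg (dist (α t) (β t))]),
    le_div_iff₀ (by positivity)] at hcos
  apply Real.le_sqrt_of_sq_le
  linarith

/-- Finiteness of the infimum is used only to produce some path of rays; its points at time `t` stay
at distance `t` from `o`. -/
theorem mem_connectedComponentIn_of_titsDist_lt_top {α β : Ray Y o} (h : titsDist α β < ⊤)
    {t : ℝ≥0} (ht : 0 < t) : β t ∈ connectedComponentIn {o}ᶜ (α t) := by
  simp only [titsDist, pathDist, iInf_lt_iff] at h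
  obtain ⟨c, ⟨hc, rfl, rfl⟩, -⟩ := h
  have hcont : Continuous fun s => c s t := by
    refine continuous_iff_continuousAt.2 fun s => ?_
    refine tendsto_iff_dist_tendsto_zero.2 ?_
    have hlim : Tendsto (fun s' => √(2 * t ^ 2 * (1 - Real.cos (angle (c s) (c s')))))
        (𝓝 s) (𝓝 0) := by
      have hf : Continuous fun θ : ℝ => √(2 * (t : ℝ) ^ 2 * (1 - Real.cos θ)) := by fun_prop
      simpa [Function.comp_def] using (hf.tendsto 0).comp (hc s)
    refine squeeze_zero (fun _ => dist_nonneg) (fun s' => ?_) hlim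
    rw [dist_comm]
    exact (c s).dist_le_sqrt_angle (c s') ht
  refine (isPreconnected_range hcont).subset_connectedComponentIn ⟨0, rfl⟩ ?_ ⟨1, rfl⟩
  rintro _ ⟨s, rfl⟩ hs
  have h := (c s).dist_source t
  rw [show c s t = o from hs, dist_self] at h
  exact ht.ne (by exact_mod_cast h)

end Evaluation

theorem pathDist_map_le {B B' : Type*} {ρ : B → B → ℝ} {ρ' : B' → B' → ℝ} {f : B → B'}
    (hρ' : ∀ a b, 0 ≤ ρ' a b) (hf : ∀ a b, ρ' (f a) (f b) ≤ ρ a b) (a b : B) :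
    pathDist ρ' (f a) (f b) ≤ pathDist ρ a b := by
  refine le_iInf₂ fun c ⟨hc, h0, h1⟩ => ?_
  subst h0 h1
  have hfc : IsPath ρ' (f ∘ c) := fun s =>
    squeeze_zero (fun _ => hρ' _ _) (fun _ => hf _ _) (hc s)
  refine (iInf₂_le (f ∘ c) ⟨hfc, rfl, rfl⟩).trans ?_
  exact iSup₂_mono fun k u => Finset.sum_le_sum fun i _ => ENNReal.ofReal_le_ofReal (hf _ _)

/-! ### Asymptotic cones -/

section Cones

variable {X : Type*} [MetricSpace X] {ω : Ultrafilter ℕ} {x₀ : X}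

/-- For an ultrafilter, not being eventually at least `C` means being eventually below `C`;
compactness of `[0, C]` would then give a limit. -/
theorem ScalingSequence.tendsto_val (d : ScalingSequence ω) :
    Tendsto (fun n => (d.val n : ℝ)) ω atTop := by
  refine tendsto_atTop.2 fun C => ?_
  by_contra h
  rw [Ultrafilter.eventually_not.symm] at h
  have hmem : (ω.map fun n => (d.val n : ℝ) : Filter ℝ) ≤ 𝓟 (Set.Icc 0 C) := by
    rw [le_principal_iff]
    change ∀ᶠ n in ω, (d.val n : ℝ) ∈ Set.Icc 0 C
    exact h.mono fun n hn => ⟨(d.val n).2, (not_le.1 hn).le⟩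
  obtain ⟨L, _, hL⟩ := isCompact_Icc.ultrafilter_le_nhds _ hmem
  exact d.divergent ⟨L, hL⟩

theorem IsNonprincipal.exists_scalingSequence (hω : IsNonprincipal ω) :
    Nonempty (ScalingSequence ω) := by
  refine ⟨⟨fun n => n + 1, fun n => by positivity, ?_⟩⟩
  rintro ⟨L, hL⟩
  have h := hL.eventually_le_const (lt_add_one L)
  refine hω _ ?_ h
  refine (Set.finite_le_nat ⌊L⌋₊).subset fun n hn => ?_
  have hn' : (n : ℝ) ≤ L := by
    have : ((n + 1 : ℝ≥0) : ℝ) ≤ L + 1 := hn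
    push_cast at this
    linarith
  exact Nat.le_floor hn'

theorem AsympCone.tendsto_dist {e : ℕ → X} {d : ScalingSequence ω} (x y : BoundedSeq ω e d) :
    Tendsto (fun n => dist (x.1 n) (y.1 n) / d.val n) ω
      (𝓝 (dist (SeparationQuotient.mk x : AsympCone ω e d) (SeparationQuotient.mk y))) :=
  BoundedSeq.tendsto x y

/-- Each comparison angle in the cone is the ultralimit of those between `α (t * d n)` and `β (t' *
d n)`, since the factor `d n` cancels. -/
theorem angle_PsiBar_le (d : ScalingSequence ω) (α β : Ray X x₀) :
    angle (PsiBar d α) (PsiBar d β) ≤ angle α β := by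
  refine csSup_le ⟨_, 1, 1, one_pos, one_pos, rfl⟩ ?_
  rintro _ ⟨t, t', ht, ht', rfl⟩
  have hlim : Tendsto (fun n => dist (α (t * d.val n)) (β (t' * d.val n)) / d.val n) ω
      (𝓝 (dist (PsiBar d α t) (PsiBar d β t'))) := AsympCone.tendsto_dist _ _
  have hf : Continuous fun D : ℝ =>
      Real.arccos (((t : ℝ) ^ 2 + t' ^ 2 - D ^ 2) / (2 * t * t')) := by fun_prop
  rw [compAngle, Ray.dist_source, Ray.dist_source]
  refine le_of_tendsto' ((hf.tendsto _).comp hlim) fun n => ?_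
  refine le_trans (le_of_eq ?_)
    (compAngle_le_angle α β (mul_pos ht (d.pos n)) (mul_pos ht' (d.pos n)))
  have hd : (d.val n : ℝ) ≠ 0 := NNReal.coe_ne_zero.2 (d.pos n).ne'
  have ht0 : (t : ℝ) ≠ 0 := NNReal.coe_ne_zero.2 ht.ne'
  have ht0' : (t' : ℝ) ≠ 0 := NNReal.coe_ne_zero.2 ht'.ne'
  rw [Function.comp_apply, compAngle, Ray.dist_source, Ray.dist_source]
  push_cast
  congr 1
  field_simp

/-- `γ` is the ultralimit of the geodesics from `x₀` to the members of a sequence representing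
the point `p` of the asymptotic cone. -/
def IsDirection {d : ScalingSequence ω} (p : AsympCone ω (fun _ => x₀) d) (γ : Ray X x₀) : Prop :=
  ∃ x : BoundedSeq ω (fun _ => x₀) d, SeparationQuotient.mk x = p ∧ ∃ G : ℕ → ℝ → X,
    (∀ n, IsGeodesicSegment x₀ (x.1 n) (G n)) ∧
      ∀ t : ℝ≥0, Tendsto (fun n => G n t) ω (𝓝 (γ t))

theorem tendsto_dist_atTop {d : ScalingSequence ω} {x : BoundedSeq ω (fun _ => x₀) d}
    (hx : (SeparationQuotient.mk x : AsympCone ω (fun _ => x₀) d) ≠ basepoint d x₀) :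
    Tendsto (fun n => dist x₀ (x.1 n)) ω atTop := by
  have h : Tendsto (fun n => dist x₀ (x.1 n) / d.val n) ω (𝓝 (dist (basepoint d x₀) _)) :=
    AsympCone.tendsto_dist _ x
  refine (h.pos_mul_atTop (dist_pos.2 hx.symm) d.tendsto_val).congr fun n => ?_
  exact div_mul_cancel₀ _ (NNReal.coe_ne_zero.2 (d.pos n).ne')

theorem IsCAT0.exists_isDirection [ProperSpace X] (hX : IsCAT0 X) {d : ScalingSequence ω}
    {p : AsympCone ω (fun _ => x₀) d} (hp : p ≠ basepoint d x₀) :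
    ∃ γ : Ray X x₀, IsDirection p γ := by
  obtain ⟨x, rfl⟩ := SeparationQuotient.surjective_mk p
  choose G hG using fun n => hX.exists_geodesic x₀ (x.1 n)
  obtain ⟨γ, hγ⟩ := exists_limit_ray_of_geodesics ω hG (tendsto_dist_atTop hp)
  exact ⟨γ, x, rfl, G, hG, hγ⟩

theorem isDirection_Psi (d : ScalingSequence ω) (t : ℝ≥0) (α : Ray X x₀) :
    IsDirection (Psi d t α) α :=
  ⟨_, rfl, fun _ s => α s.toNNReal, fun n => α.isGeodesicSegment (t * d.val n), fun s => by simp⟩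

/-- A strict inequality between ultralimits holds `ω`-eventually between the sequences, whichever
representatives define the two directions. -/
theorem IsCAT0.chordLE_of_isDirection (hX : IsCAT0 X) {d : ScalingSequence ω}
    {p q : AsympCone ω (fun _ => x₀) d} (hp : p ≠ basepoint d x₀) (hq : q ≠ basepoint d x₀)
    {φ : ℝ} (hφ₀ : 0 ≤ φ) (hφ : φ ≤ Real.pi / 2)
    (hpq : dist p q < Real.sin φ * dist (basepoint d x₀) p)
    {γ γ' : Ray X x₀} (hγ : IsDirection p γ) (hγ' : IsDirection q γ') :
    ChordLE γ γ' (2 * Real.sin (φ / 2)) := by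
  obtain ⟨x, rfl, G, hG, hGγ⟩ := hγ
  obtain ⟨y, rfl, H, hH, hHγ⟩ := hγ'
  refine hX.chordLE_of_tendsto ω hG hH (tendsto_dist_atTop hp) (tendsto_dist_atTop hq) hGγ hHγ
    hφ₀ hφ ?_
  have h1 : Tendsto (fun n => Real.sin φ * (dist x₀ (x.1 n) / d.val n)) ω
      (𝓝 (Real.sin φ * dist (basepoint d x₀) _)) := (AsympCone.tendsto_dist _ x).const_mul _
  filter_upwards [(AsympCone.tendsto_dist x y).eventually_lt h1 hpq] with n hn
  have hd : (0 : ℝ) < d.val n := d.pos n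
  rw [← mul_div_assoc] at hn
  exact ((div_lt_div_iff_of_pos_right hd).1 hn).le

/-- Within radius `sin φ * dist (basepoint d x₀) p` of `p`, directions are one step away from those
of `p`. Being joined by a chain is thus a locally constant relation, and connectedness spreads it
over the component. -/
theorem IsCAT0.reflTransGen_of_mem_connectedComponentIn [ProperSpace X] (hX : IsCAT0 X)
    {d : ScalingSequence ω} {t : ℝ≥0} (ht : 0 < t) {φ : ℝ} (hφ₀ : 0 < φ) (hφ : φ ≤ Real.pi / 2)
    {α β : Ray X x₀} (h : Psi d t β ∈ connectedComponentIn {basepoint d x₀}ᶜ (Psi d t α)) :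
    Relation.ReflTransGen (fun γ γ' => ChordLE γ γ' (2 * Real.sin (φ / 2))) α β := by
  have hsin : 0 < Real.sin φ := Real.sin_pos_of_pos_of_lt_pi hφ₀ (by linarith [Real.pi_pos])
  have hα : Psi d t α ∈ ({basepoint d x₀}ᶜ : Set (AsympCone ω (fun _ => x₀) d)) := by
    intro h0
    have h1 := (PsiBar d α).dist_source t
    rw [show PsiBar d α t = basepoint d x₀ from h0, dist_self] at h1
    exact ht.ne (by exact_mod_cast h1)
  refine isPreconnected_connectedComponentIn.induction₂
    -- Quantifying over all directions avoids a choice at each point; transitivity then needs only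
    -- that the middle point has one.
    (fun p q => ∀ γ γ', IsDirection p γ → IsDirection q γ' →
      Relation.ReflTransGen (fun γ γ' => ChordLE γ γ' (2 * Real.sin (φ / 2))) γ γ')
    (fun p hp => ?_) (fun p q r _ hq _ hpq hqr γ γ' hγ hγ' => ?_)
    (fun p q _ _ hpq γ γ' hγ hγ' => ?_) (mem_connectedComponentIn hα) h _ _
    (isDirection_Psi d t α) (isDirection_Psi d t β)
  · have hp0 := connectedComponentIn_subset _ _ hp
    have hpos : 0 < Real.sin φ * dist (basepoint d x₀) p :=
      mul_pos hsin (dist_pos.2 (Ne.symm hp0))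
    filter_upwards [self_mem_nhdsWithin, nhdsWithin_le_nhds (Metric.ball_mem_nhds p hpos)]
      with q hq hpq γ γ' hγ hγ'
    rw [Metric.mem_ball, dist_comm] at hpq
    exact .single (hX.chordLE_of_isDirection hp0 (connectedComponentIn_subset _ _ hq) hφ₀.le hφ
      hpq hγ hγ')
  · obtain ⟨δ, hδ⟩ := hX.exists_isDirection (connectedComponentIn_subset _ _ hq)
    exact (hpq γ δ hγ hδ).trans (hqr δ γ' hδ hγ')
  · have : Std.Symm fun γ γ' : Ray X x₀ => ChordLE γ γ' (2 * Real.sin (φ / 2)) :=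
      ⟨fun _ _ h => h.symm⟩
    exact Relation.ReflTransGen.stdSymm.symm _ _ (hpq γ' γ hγ' hγ)

end Cones

end CatZero

theorem mainTheorem7 {X : Type*} [MetricSpace X] [ProperSpace X] (hX : CatZero.IsCAT0 X) (x₀ : X)
    (ω : Ultrafilter ℕ) (hω : CatZero.IsNonprincipal ω) (α β : CatZero.Ray X x₀) :
    List.TFAE [
      CatZero.titsDist α β < ⊤,
      ∀ d : CatZero.ScalingSequence ω,
        CatZero.titsDist (CatZero.PsiBar d α) (CatZero.PsiBar d β) < ⊤,
      ∃ d : CatZero.ScalingSequence ω,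
        CatZero.titsDist (CatZero.PsiBar d α) (CatZero.PsiBar d β) < ⊤,
      ∀ d : CatZero.ScalingSequence ω, ∀ t : ℝ≥0, 0 < t →
        CatZero.Psi d t β ∈
          connectedComponentIn {CatZero.basepoint d x₀}ᶜ (CatZero.Psi d t α),
      ∃ d : CatZero.ScalingSequence ω, ∀ t : ℝ≥0, 0 < t →
        CatZero.Psi d t β ∈
          connectedComponentIn {CatZero.basepoint d x₀}ᶜ (CatZero.Psi d t α),
      ∀ d : CatZero.ScalingSequence ω, ∃ t : ℝ≥0, 0 < t ∧
        CatZero.Psi d t β ∈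
          connectedComponentIn {CatZero.basepoint d x₀}ᶜ (CatZero.Psi d t α),
      ∃ d : CatZero.ScalingSequence ω, ∃ t : ℝ≥0, 0 < t ∧
        CatZero.Psi d t β ∈
          connectedComponentIn {CatZero.basepoint d x₀}ᶜ (CatZero.Psi d t α)] := by
  -- A scaling sequence must exist for "every" to imply "some".
  obtain ⟨d₀⟩ := hω.exists_scalingSequence
  tfae_have 1 → 2 := fun h d =>
    (CatZero.pathDist_map_le CatZero.angle_nonneg (CatZero.angle_PsiBar_le d) α β).trans_lt h
  tfae_have 2 → 3 := fun h => ⟨d₀, h d₀⟩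
  tfae_have 2 → 4 := fun h d _ ht =>
    CatZero.mem_connectedComponentIn_of_titsDist_lt_top (h d) ht
  tfae_have 3 → 5 := fun ⟨d, h⟩ =>
    ⟨d, fun _ ht => CatZero.mem_connectedComponentIn_of_titsDist_lt_top h ht⟩
  tfae_have 4 → 6 := fun h d => ⟨1, one_pos, h d 1 one_pos⟩
  tfae_have 5 → 7 := fun ⟨d, h⟩ => ⟨d, 1, one_pos, h 1 one_pos⟩
  tfae_have 6 → 7 := fun h => ⟨d₀, h d₀⟩
  tfae_have 7 → 1 := fun ⟨d, t, ht, h⟩ => by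
    have hpi := Real.pi_pos
    -- Taking `φ = π / 2` in the connectedness argument gives chords `2 * sin (π / 4)`, and `π / 4`
    -- meets the strict bound required for halving.
    exact hX.titsDist_lt_top_of_reflTransGen (φ := Real.pi / 2 / 2) (by positivity) (by linarith)
      (hX.reflTransGen_of_mem_connectedComponentIn ht (by positivity) le_rfl h)
  tfae_finish
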